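/- Let $q$ be a prime power, let $n\ge 1$, and let $\mathrm{GL}_n(\mathbb F_q)$ act on $S=\mathbb F_q[x_1,\dots,x_n]$ by linear substitutions, $(\sigma f)(x_1,\dots,x_n)=f(\sigma x_1,\dots,\sigma x_n)$ with $\sigma x_j=\sum_{i=1}^n\sigma_{ij}x_i$. Let $\mathrm B_n\le \mathrm{GL}_n(\mathbb F_q)$ be the Borel subgroup of invertible upper triangular matrices, and let $$S_{\mathrm B_n}=S\big/\operatorname{span}_{\mathbb F_q}\{\sigma f-f : \sigma\in \mathrm B_n,\ f\in S\}$$ be the cofixed space, graded by $(S_{\mathrm B_n})_d=$ the image of the homogeneous polynomials of degree $d$. For a sequence $\alpha=(\alpha_1,\dots,\alpha_\ell)$ of non-negative integers, put $$\widehat C_\alpha(t)=\sum_{\beta\le\alpha} t^{\sum_{i=1}^{\ell}\alpha_i(q^{B_i}-1)}\prod_{i=1}^{\ell}\prod_{j=0}^{\beta_i-1}\frac{1}{1-t^{\,q^{B_i}-q^{B_{i-1}+j}}},\qquad B_i=\beta_1+\cdots+\beta_i,\quad B_0=0,$$ where the sum is over all $\beta=(\beta_1,\dots,\beta_\ell)$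 of integers with $0\le\beta_i\le\alpha_i$ for all $i$; this is the Hilbert series conjectured by Lewis, Reiner and Stanton for the cofixed space of the parabolic subgroup $\mathrm P_\alpha$. Then the conjecture is true for the Borel subgroup, i.e. for $\alpha=1^n=(1,\dots,1)$ ($n$ entries): for all $n\ge1$, $$\sum_{d\ge 0}\dim_{\mathbb F_q}\big((S_{\mathrm B_n})_d\big)\,t^d=\widehat C_{1^n}(t)=\sum_{\beta\in\{0,1\}^n}t^{\sum_{i=1}^n(q^{B_i}-1)}\prod_{i:\,\beta_i=1}\frac{1}{1-t^{\,q^{B_i}-q^{B_i-1}}}.$$ -/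

import Mathlib

open MvPolynomial

noncomputable section

namespace LRS

/-- The endomorphism of the polynomial algebra given by the linear substitution
`x_j ↦ ∑ i, σ i j * x_i`. -/
def linSubst {K : Type*} [Field K] {n : ℕ} (σ : Matrix (Fin n) (Fin n) K) :
    MvPolynomial (Fin n) K →ₐ[K] MvPolynomial (Fin n) K :=
  aeval fun j => ∑ i, C (σ i j) * X i

theorem linSubst_one {K : Type*} [Field K] {n : ℕ} :
    linSubst (1 : Matrix (Fin n) (Fin n) K) = AlgHom.id K _ := by
  ext1 j
  simp [linSubst, Matrix.one_apply]

theorem linSubst_mul {K : Type*} [Field K] {n : ℕ} (σ τ : Matrix (Fin n) (Fin n) K) :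
    linSubst (σ * τ) = (linSubst σ).comp (linSubst τ) := by
  ext1 j
  simp only [linSubst, AlgHom.comp_apply, aeval_X, map_sum, map_mul, Matrix.mul_apply,
    Finset.sum_mul, Finset.mul_sum, algHom_C, algebraMap_eq]
  rw [Finset.sum_comm]
  refine Finset.sum_congr rfl fun i _ => Finset.sum_congr rfl fun k _ => ?_
  ring

/-- The representation of `GL_n(K)` on `K[x_1, …, x_n]` by linear substitutions,
`(σ f)(x_1, …, x_n) = f(σ x_1, …, σ x_n)` with `σ x_j = ∑ i, σ i j * x_i`. -/
def polyRep (K : Type*) [Field K] (n : ℕ) :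
    Representation K (GL (Fin n) K) (MvPolynomial (Fin n) K) where
  toFun σ := (linSubst (σ : Matrix (Fin n) (Fin n) K)).toLinearMap
  map_one' := by
    rw [Units.val_one, linSubst_one]; rfl
  map_mul' σ τ := by
    rw [Units.val_mul, linSubst_mul]; rfl

/-- The Borel subgroup of `GL_n(K)`: the invertible upper triangular matrices. -/
def borel (K : Type*) [Field K] (n : ℕ) : Subgroup (GL (Fin n) K) where
  carrier := {σ | (σ : Matrix (Fin n) (Fin n) K).IsUpperTriangular}
  one_mem' := by
    simpa using Matrix.blockTriangular_one
  mul_mem' hσ hτ := by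
    simpa using Matrix.BlockTriangular.mul hσ hτ
  inv_mem' {σ} hσ := by
    have : Invertible (σ : Matrix (Fin n) (Fin n) K) := Units.invertible σ
    simpa [Matrix.coe_units_inv] using Matrix.blockTriangular_inv_of_blockTriangular hσ

/-- The polynomial representation restricted to the Borel subgroup. -/
def borelRep (K : Type*) [Field K] (n : ℕ) :
    Representation K (borel K n) (MvPolynomial (Fin n) K) :=
  (polyRep K n).comp (borel K n).subtype

/-- The cofixed space `K[x_1, …, x_n]_{B_n}`: the quotient of `K[x_1, …, x_n]` by the
`K`-span of all `σ f - f` with `σ` in the Borel subgroup and `f` a polynomial. -/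
abbrev Cofixed (K : Type*) [Field K] (n : ℕ) : Type _ :=
  (borelRep K n).Coinvariants

/-- The degree `d` piece of the cofixed space: the image of the homogeneous polynomials of
degree `d`. -/
def cofixedPiece (K : Type*) [Field K] (n d : ℕ) : Submodule K (Cofixed K n) :=
  (homogeneousSubmodule (Fin n) K d).map (Representation.Coinvariants.mk (borelRep K n))

instance cofixedPiece_finite (K : Type*) [Field K] (n d : ℕ) : Module.Finite K (cofixedPiece K n d) :=
  Module.Finite.iff_fg.mpr ((homogeneousSubmodule_fg (Fin n) K d).map _)

theorem linSubst_isHomogeneous {K : Type*} [Field K] {n d : ℕ} (σ : Matrix (Fin n) (Fin n) K)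
    {f : MvPolynomial (Fin n) K} (hf : f.IsHomogeneous d) :
    (linSubst σ f).IsHomogeneous d := by
  have h := hf.aeval (fun j => ∑ i, C (σ i j) * X i) (n := 1) fun j =>
    IsHomogeneous.sum _ _ _ fun i _ => by
      simpa using (isHomogeneous_C (Fin n) (σ i j)).mul (isHomogeneous_X K i)
  simpa [linSubst] using h

theorem homogeneousComponent_linSubst {K : Type*} [Field K] {n : ℕ} (d : ℕ)
    (σ : Matrix (Fin n) (Fin n) K) (f : MvPolynomial (Fin n) K) :
    homogeneousComponent d (linSubst σ f) = linSubst σ (homogeneousComponent d f) := by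
  conv_lhs => rw [← sum_homogeneousComponent f, map_sum, map_sum]
  rw [Finset.sum_congr rfl fun e _ => homogeneousComponent_of_mem
    (linSubst_isHomogeneous σ (homogeneousComponent_isHomogeneous e f))]
  rw [Finset.sum_ite_eq]
  split_ifs with h
  · rfl
  · rw [homogeneousComponent_eq_zero d f (by simpa using h), map_zero]

/-- The cofixed space is graded by its degree pieces. -/
theorem isInternal_cofixedPiece (K : Type*) [Field K] (n : ℕ) :
    DirectSum.IsInternal (cofixedPiece K n) := by
  have key (d : ℕ) : ∃ p : Cofixed K n →ₗ[K] Cofixed K n, ∀ e, ∀ x ∈ cofixedPiece K n e,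
      p x = if e = d then x else 0 := by
    refine ⟨Representation.Coinvariants.lift (borelRep K n)
      (Representation.Coinvariants.mk (borelRep K n) ∘ₗ homogeneousComponent d) ?_, ?_⟩
    · intro g
      refine LinearMap.ext fun f => ?_
      have := homogeneousComponent_linSubst d ((g : GL (Fin n) K) : Matrix (Fin n) (Fin n) K) f
      have h : Representation.Coinvariants.mk (borelRep K n)
          (homogeneousComponent d (borelRep K n g f)) =
          Representation.Coinvariants.mk (borelRep K n)
            (borelRep K n g (homogeneousComponent d f)) :=
        congrArg _ this
      exact h.trans (Representation.Coinvariants.mk_self_apply (borelRep K n) g _)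
    · rintro e _ ⟨f, hf, rfl⟩
      rw [Representation.Coinvariants.lift_mk, LinearMap.comp_apply,
        homogeneousComponent_of_mem hf]
      by_cases h : e = d
      · simp [h]
      · simp [h, Ne.symm h]
  rw [DirectSum.isInternal_submodule_iff_iSupIndep_and_iSup_eq_top]
  constructor
  · intro d
    obtain ⟨p, hp⟩ := key d
    rw [Submodule.disjoint_def]
    intro x hx hx'
    have hle : (⨆ j, ⨆ (_ : j ≠ d), cofixedPiece K n j) ≤ LinearMap.ker p :=
      iSup₂_le fun j hj y hy => by rw [LinearMap.mem_ker, hp j y hy, if_neg hj]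
    have h0 : p x = 0 := hle hx'
    rwa [hp d x hx, if_pos rfl] at h0
  · rw [eq_top_iff]
    rintro x -
    obtain ⟨f, rfl⟩ := Representation.Coinvariants.mk_surjective (borelRep K n) x
    rw [← sum_homogeneousComponent f, map_sum]
    exact Submodule.sum_mem _ fun d _ => Submodule.mem_iSup_of_mem d
      ⟨_, homogeneousComponent_mem d f, rfl⟩

/-- The Hilbert series `∑ d, dim (M_d) t^d` of a family of subspaces `M_d`. -/
def hilbertSeries {K V : Type*} [Field K] [AddCommGroup V] [Module K V]
    (M : ℕ → Submodule K V) : PowerSeries ℚ :=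
  PowerSeries.mk fun d => (Module.finrank K (M d) : ℚ)

/-- The conjectured Hilbert series of the cofixed space of the parabolic subgroup `P_α`:
`∑_{β ≤ α} t^{∑_i α_i (q^{B_i} - 1)} / ∏_i ∏_{0 ≤ j < β_i} (1 - t^{q^{B_i} - q^{B_{i-1} + j}})`,
where `B_i = β_1 + ⋯ + β_i`. All the subtractions of natural numbers here are genuine, and all
the exponents in the denominators are positive when `2 ≤ q`. -/
def conjecturedCofixedSeries (q : ℕ) {l : ℕ} (α : Fin l → ℕ) : PowerSeries ℚ :=
  ∑ β ∈ Finset.Iic α,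
    (PowerSeries.X ^ (∑ i, α i * (q ^ (∑ j ∈ Finset.Iic i, β j) - 1)) *
      ∏ i, ∏ j ∈ Finset.range (β i),
        (1 - PowerSeries.X ^
          (q ^ (∑ k ∈ Finset.Iic i, β k) - q ^ ((∑ k ∈ Finset.Iio i, β k) + j)))⁻¹)

end LRS

end

/-! The proof is by induction on the number of variables. Write q for the order of K and number the
n + 1 variables from 0, so that every Borel element scales x_0, and split off x_0. The cofixed space
in n + 1 variables is a direct sum of copies of the one in n variables: one with its own grading,
and for each k ≥ 0 one in which degree d becomes (q - 1)(n + 1) + (q - 1)k + qd. Hence H_{n+1}(t) =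
H_n(t) + t^{(q-1)(n+1)} / (1 - t^{q-1}) · H_n(t^q). The conjectured series satisfies the same
recursion, by splitting the sum according to β_0 ∈ {0, 1}.

The first copy is split off by restriction to x_0 = 0. In the rest, scaling x_0 kills x_0^k f(x_1,
…, x_n) unless q - 1 divides k, so only x_0^{q-1} S matters. The translations x_i ↦ x_i + u_i x_0
fix x_0 and the polynomials x_i^q - x_0^{q-1} x_i. Over the algebra A generated by these, which is
the image of `artin`, S is spanned by the monomials in x_1, …, x_n with all exponents at most q - 1.
After multiplication by x_0^{q-1}, every such monomial except the top one, ∏ x_i^{q-1}, lies in the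
span of the differences, by a power-sum identity over K
(`X_zero_pow_mul_mem_borelKer_of_mem_lowSpan`). This leaves the multiples of x_0^{q-1} ∏ x_i^{q-1}
by elements of A, and scaling x_0 again leaves only the images of `thicken`.

Independence comes from the transfer over the translations. It is A-linear, kills the non-top
monomials and sends the top one to ± x_0^{(q-1)n}. Divided by this power it is Borel-equivariant,
and its coefficients at powers of x_0^{q-1} recover the thickened copies
(`cofixedTransfer_cofixedThicken`). The same computation shows that the thickening maps are well
defined on the cofixed space (`mk_thicken_linSubst`). -/

noncomputable section

namespace LRS

open Representation

/-! ### Block form of Borel substitutions and expansion in powers of x_0 -/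

section

variable {K : Type*} [Field K] {n : ℕ}

/-- The block matrix with corner `a`, remaining first row `u`, and lower right block `σ`. -/
def blockMat (a : K) (u : Fin n → K) (σ : Matrix (Fin n) (Fin n) K) :
    Matrix (Fin (n + 1)) (Fin (n + 1)) K :=
  Matrix.of (Fin.cons (Fin.cons a u) fun i => Fin.cons 0 (σ i))

theorem linSubst_X (σ : Matrix (Fin n) (Fin n) K) (j : Fin n) :
    linSubst σ (X j) = ∑ i, C (σ i j) * X i := by
  simp [linSubst]

@[simp]
theorem linSubst_blockMat_X_zero (a : K) (u : Fin n → K) (σ : Matrix (Fin n) (Fin n) K) :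
    linSubst (blockMat a u σ) (X 0) = C a * X 0 := by
  simp [linSubst_X, Fin.sum_univ_succ, blockMat]

@[simp]
theorem linSubst_blockMat_X_succ (a : K) (u : Fin n → K) (σ : Matrix (Fin n) (Fin n) K)
    (j : Fin n) :
    linSubst (blockMat a u σ) (X j.succ) = C (u j) * X 0 + rename Fin.succ (linSubst σ (X j)) := by
  simp [linSubst_X, Fin.sum_univ_succ, blockMat]

theorem blockMat_eq_of_isUpperTriangular {σ : Matrix (Fin (n + 1)) (Fin (n + 1)) K}
    (hσ : σ.IsUpperTriangular) :
    blockMat (σ 0 0) (fun j => σ 0 j.succ) (σ.submatrix Fin.succ Fin.succ) = σ := by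
  ext i j
  refine Fin.cases ?_ (fun i => ?_) i <;> refine Fin.cases ?_ (fun j => ?_) j
  · rfl
  · rfl
  · exact (hσ (Fin.succ_pos i)).symm
  · rfl

theorem isUpperTriangular_blockMat {a : K} {u : Fin n → K} {σ : Matrix (Fin n) (Fin n) K}
    (hσ : σ.IsUpperTriangular) : (blockMat a u σ).IsUpperTriangular := by
  intro i j
  refine Fin.cases ?_ (fun i => ?_) i <;> refine Fin.cases ?_ (fun j => ?_) j
  · intro h; exact absurd h (lt_irrefl _)
  · intro h; exact absurd h (by simp)
  · intro _; rfl
  · intro h; exact hσ (Fin.succ_lt_succ_iff.mp h)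

/-- Upper triangular matrices with nonzero diagonal. -/
def IsBorel (σ : Matrix (Fin n) (Fin n) K) : Prop :=
  σ.IsUpperTriangular ∧ ∀ i, σ i i ≠ 0

theorem IsBorel.one : IsBorel (1 : Matrix (Fin n) (Fin n) K) :=
  ⟨Matrix.blockTriangular_one, fun i => by simp⟩

theorem IsBorel.blockMat {a : K} (ha : a ≠ 0) (u : Fin n → K) {σ : Matrix (Fin n) (Fin n) K}
    (hσ : IsBorel σ) : IsBorel (blockMat a u σ) :=
  ⟨isUpperTriangular_blockMat hσ.1, Fin.cases ha hσ.2⟩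

theorem IsBorel.det_ne_zero {σ : Matrix (Fin n) (Fin n) K} (hσ : IsBorel σ) : σ.det ≠ 0 := by
  rw [Matrix.det_of_isUpperTriangular hσ.1]
  exact Finset.prod_ne_zero_iff.mpr fun i _ => hσ.2 i

theorem IsBorel.exists_blockMat {σ : Matrix (Fin (n + 1)) (Fin (n + 1)) K} (hσ : IsBorel σ) :
    ∃ (a : K) (u : Fin n → K) (τ : Matrix (Fin n) (Fin n) K), a ≠ 0 ∧ IsBorel τ ∧
      σ = LRS.blockMat a u τ :=
  ⟨_, _, _, hσ.2 0, ⟨fun _ _ h => hσ.1 (Fin.succ_lt_succ_iff.mpr h), fun i => hσ.2 i.succ⟩,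
    (blockMat_eq_of_isUpperTriangular hσ.1).symm⟩

/-- The span of the differences `σ f - f` with `σ` in the Borel subgroup. -/
abbrev borelKer (K : Type*) [Field K] (n : ℕ) : Submodule K (MvPolynomial (Fin n) K) :=
  Coinvariants.ker (borelRep K n)

theorem IsBorel.sub_mem_borelKer {σ : Matrix (Fin n) (Fin n) K} (hσ : IsBorel σ)
    (f : MvPolynomial (Fin n) K) : linSubst σ f - f ∈ borelKer K n :=
  Coinvariants.sub_mem_ker (ρ := borelRep K n)
    ⟨Matrix.GeneralLinearGroup.mkOfDetNeZero σ hσ.det_ne_zero, hσ.1⟩ f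

theorem isBorel_of_mem_borel (g : borel K n) :
    IsBorel ((g : GL (Fin n) K) : Matrix (Fin n) (Fin n) K) := by
  refine ⟨g.2, fun i hi => ?_⟩
  have h := (Matrix.isUnit_iff_isUnit_det _).mp (g : GL (Fin n) K).isUnit
  rw [Matrix.det_of_isUpperTriangular g.2] at h
  exact h.ne_zero (Finset.prod_eq_zero (Finset.mem_univ i) hi)

/-- A linear map out of the cofixed space, from a Borel-invariant linear map on polynomials. -/
def cofixedLift {W : Type*} [AddCommGroup W] [Module K W] (φ : MvPolynomial (Fin n) K →ₗ[K] W)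
    (h : ∀ σ : Matrix (Fin n) (Fin n) K, IsBorel σ → ∀ f, φ (linSubst σ f) = φ f) :
    Cofixed K n →ₗ[K] W :=
  Coinvariants.lift (borelRep K n) φ fun g => LinearMap.ext fun f => h _ (isBorel_of_mem_borel g) f

@[simp]
theorem cofixedLift_mk {W : Type*} [AddCommGroup W] [Module K W]
    (φ : MvPolynomial (Fin n) K →ₗ[K] W)
    (h : ∀ σ : Matrix (Fin n) (Fin n) K, IsBorel σ → ∀ f, φ (linSubst σ f) = φ f)
    (f : MvPolynomial (Fin n) K) :
    cofixedLift φ h (Coinvariants.mk (borelRep K n) f) = φ f := rfl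

theorem mk_linSubst {σ : Matrix (Fin n) (Fin n) K} (hσ : IsBorel σ)
    (f : MvPolynomial (Fin n) K) :
    Coinvariants.mk (borelRep K n) (linSubst σ f) = Coinvariants.mk (borelRep K n) f :=
  (Coinvariants.mk_eq_iff _).mpr (hσ.sub_mem_borelKer f)

theorem linSubst_blockMat_rename (a : K) (σ : Matrix (Fin n) (Fin n) K)
    (f : MvPolynomial (Fin n) K) :
    linSubst (blockMat a 0 σ) (rename Fin.succ f) = rename Fin.succ (linSubst σ f) := by
  have : (linSubst (blockMat a 0 σ)).comp (rename Fin.succ) =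
      (rename Fin.succ).comp (linSubst σ) := by
    ext1 j
    simp
  exact DFunLike.congr_fun this f

/-- A translation by a multiple of `x_0` followed by a block substitution. -/
theorem linSubst_blockMat_comp {a : K} (ha : a ≠ 0) (u v : Fin n → K)
    (σ : Matrix (Fin n) (Fin n) K) (f : MvPolynomial (Fin (n + 1)) K) :
    linSubst (blockMat 1 v 1) (linSubst (blockMat a u σ) f) =
      linSubst (blockMat a 0 σ) (linSubst (blockMat 1 (a⁻¹ • (u + Matrix.vecMul v σ)) 1) f) := by
  rw [← AlgHom.comp_apply, ← AlgHom.comp_apply, ← linSubst_mul, ← linSubst_mul]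
  congr 2
  ext i j
  refine Fin.cases ?_ (fun i => ?_) i <;> refine Fin.cases ?_ (fun j => ?_) j <;>
    simp [Matrix.mul_apply, Fin.sum_univ_succ, blockMat, Matrix.vecMul, dotProduct,
      Matrix.one_apply]
  field_simp

theorem finSuccEquiv_rename_succ (f : MvPolynomial (Fin n) K) :
    finSuccEquiv K n (rename Fin.succ f) = Polynomial.C f := by
  induction f using MvPolynomial.induction_on with
  | C a => simp [finSuccEquiv_apply]
  | add p q hp hq => simp [hp, hq]
  | mul_X p i hp => simp [hp, finSuccEquiv_X_succ]

/-- The monomials `x_0 ^ k * h(x_1, …, x_n)` span. -/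
theorem eq_top_of_X_zero_pow_mul_rename_mem (P : Submodule K (MvPolynomial (Fin (n + 1)) K))
    (h : ∀ (k : ℕ) (f : MvPolynomial (Fin n) K), X 0 ^ k * rename Fin.succ f ∈ P) : P = ⊤ := by
  rw [eq_top_iff]
  rintro f -
  obtain ⟨p, rfl⟩ := (finSuccEquiv K n).symm.surjective f
  have key (g : MvPolynomial (Fin n) K) : (finSuccEquiv K n).symm (Polynomial.C g) =
      rename Fin.succ g := by
    rw [AlgEquiv.symm_apply_eq, finSuccEquiv_rename_succ]
  induction p using Polynomial.induction_on' with
  | add p q hp hq => rw [map_add]; exact P.add_mem hp hq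
  | monomial k g =>
    rw [← Polynomial.C_mul_X_pow_eq_monomial, map_mul, map_pow, key, ← finSuccEquiv_X_zero,
      AlgEquiv.symm_apply_apply, mul_comm]
    exact h k g

/-- The coefficient of `x_0 ^ k`. -/
def coeffZero (k : ℕ) : MvPolynomial (Fin (n + 1)) K →ₗ[K] MvPolynomial (Fin n) K :=
  ((Polynomial.lcoeff (MvPolynomial (Fin n) K) k).restrictScalars K) ∘ₗ
    (finSuccEquiv K n).toLinearMap

theorem coeffZero_X_zero_pow_mul_rename (k l : ℕ) (f : MvPolynomial (Fin n) K) :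
    coeffZero k (X 0 ^ l * rename Fin.succ f) = if k = l then f else 0 := by
  simp [coeffZero, finSuccEquiv_rename_succ, finSuccEquiv_X_zero, mul_comm (Polynomial.X ^ l),
    Polynomial.coeff_X_pow]

theorem coeffZero_linSubst_blockMat (k : ℕ) (a : K) (σ : Matrix (Fin n) (Fin n) K)
    (f : MvPolynomial (Fin (n + 1)) K) :
    coeffZero k (linSubst (blockMat a 0 σ) f) = a ^ k • linSubst σ (coeffZero k f) := by
  have := eq_top_of_X_zero_pow_mul_rename_mem
    (LinearMap.eqLocus ((coeffZero k) ∘ₗ (linSubst (blockMat a 0 σ)).toLinearMap)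
      (a ^ k • ((linSubst σ).toLinearMap ∘ₗ (coeffZero k)))) fun l g => by
    rw [LinearMap.mem_eqLocus]
    simp only [LinearMap.comp_apply, AlgHom.toLinearMap_apply, map_mul, map_pow,
      linSubst_blockMat_X_zero, linSubst_blockMat_rename, mul_pow, LinearMap.smul_apply,
      coeffZero_X_zero_pow_mul_rename]
    rw [← C_pow, mul_assoc, C_mul', map_smul, coeffZero_X_zero_pow_mul_rename]
    split_ifs with h <;> simp [h]
  have hf : f ∈ (⊤ : Submodule K (MvPolynomial (Fin (n + 1)) K)) := trivial
  rw [← this] at hf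
  exact hf

end

section

/-! ### Power-sum identities over a finite field -/

section FiniteField

variable {K : Type*} [Field K] [Fintype K]

theorem card_sub_one_pos (K : Type*) [Field K] [Fintype K] : 0 < Fintype.card K - 1 :=
  Nat.sub_pos_of_lt Fintype.one_lt_card

theorem card_eq_card_sub_one_add_one (K : Type*) [Field K] [Fintype K] :
    Fintype.card K = Fintype.card K - 1 + 1 :=
  (Nat.sub_add_cancel Fintype.card_pos).symm

theorem sum_pow_of_pos {k : ℕ} (hk : 0 < k) :
    ∑ c : K, c ^ k = if Fintype.card K - 1 ∣ k then -1 else 0 := by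
  classical
  rw [← FiniteField.sum_pow_units K k, ← Finset.sum_subset
    (Finset.subset_univ (Finset.univ.image (Units.val : Kˣ → K))), Finset.sum_image]
  · intro a _ b _ h
    exact Units.ext h
  · intro x _ hx
    have : x = 0 := by
      by_contra h
      exact hx (Finset.mem_image.mpr ⟨Units.mk0 x h, Finset.mem_univ _, rfl⟩)
    rw [this, zero_pow hk.ne']

variable {R : Type*} [CommRing R] [Algebra K R]

/-- Only powers of c below q - 1 occur in the expansion, and each of them sums to zero over K; for
c^0 the sum is q = 0. -/
theorem sum_add_smul_pow_of_lt {j : ℕ} (hj : j < Fintype.card K - 1) (x y : R) :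
    ∑ c : K, (x + c • y) ^ j = 0 := by
  simp_rw [add_pow]
  rw [Finset.sum_comm]
  refine Finset.sum_eq_zero fun i hi => ?_
  simp_rw [smul_pow, mul_smul_comm, smul_mul_assoc]
  rw [← Finset.sum_smul, FiniteField.sum_pow_lt_card_sub_one _ _ (by omega), zero_smul]

variable [IsDomain R]

variable (K) in
-- For x ≠ y, both sides times x - y equal x^q - y^q, because Frobenius is additive. For x = y, the
-- right side is q equal terms, hence zero.
theorem sub_pow_card_sub_one_eq_sum (x y : R) :
    (x - y) ^ (Fintype.card K - 1) =
      ∑ i ∈ Finset.range (Fintype.card K), x ^ i * y ^ (Fintype.card K - 1 - i) := by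
  by_cases h : x = y
  · subst h
    rw [sub_self, zero_pow (card_sub_one_pos K).ne', Finset.sum_congr rfl fun i hi => by
      rw [← pow_add, Nat.add_sub_cancel' (Nat.le_sub_one_of_lt (Finset.mem_range.mp hi))]]
    rw [Finset.sum_const, Finset.card_range, ← Nat.cast_smul_eq_nsmul K,
      FiniteField.cast_card_eq_zero, zero_smul]
  · refine mul_right_cancel₀ (sub_ne_zero.mpr h) ?_
    rw [geom_sum₂_mul, ← pow_succ, ← card_eq_card_sub_one_add_one]
    exact map_sub (FiniteField.frobeniusAlgHom K R) x y

/-- Expanding the power leaves power sums of c with exponents j + (q - 1 - i); among the i ≤ q - 1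
only i = j gives a nonzero sum, namely -1. -/
theorem sum_pow_smul_sub_smul_pow {j : ℕ} (hj : j < Fintype.card K - 1) (x y : R) :
    ∑ c : K, c ^ j • (x - c • y) ^ (Fintype.card K - 1) =
      -(x ^ j * y ^ (Fintype.card K - 1 - j)) := by
  have hq := card_sub_one_pos K
  calc _ = ∑ i ∈ Finset.range (Fintype.card K),
        (∑ c : K, c ^ (j + (Fintype.card K - 1 - i))) •
          (x ^ i * y ^ (Fintype.card K - 1 - i)) := by
        simp_rw [sub_pow_card_sub_one_eq_sum K, Finset.smul_sum, Finset.sum_smul]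
        rw [Finset.sum_comm]
        refine Finset.sum_congr rfl fun i _ => Finset.sum_congr rfl fun c _ => ?_
        rw [smul_pow, pow_add, mul_smul, mul_smul_comm]
    _ = _ := by
        rw [Finset.sum_eq_single j]
        · rw [sum_pow_of_pos (by omega), if_pos (by
            rw [Nat.add_sub_cancel' hj.le]), neg_one_smul]
        · intro i hi hij
          rw [Finset.mem_range] at hi
          -- Exponent zero (j = 0, i = q - 1) is separate: q - 1 divides it, yet with 0^0 = 1 the
          -- sum is q = 0 and not -1.
          by_cases h0 : j + (Fintype.card K - 1 - i) = 0
          · rw [h0, FiniteField.sum_pow_lt_card_sub_one _ _ hq, zero_smul]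
          · rw [sum_pow_of_pos (Nat.pos_of_ne_zero h0), if_neg, zero_smul]
            intro hd
            obtain ⟨m, hm⟩ := hd
            have : m = 1 := by
              have h1 : m ≠ 0 := by rintro rfl; omega
              have h2 : m < 2 := by
                by_contra h
                have := Nat.mul_le_mul_left (Fintype.card K - 1) (not_lt.mp h)
                omega
              omega
            subst this
            omega
        · intro h
          exact absurd (Finset.mem_range.mpr (by omega)) h

theorem sum_add_smul_pow_card_sub_one (x y : R) :
    ∑ c : K, (x + c • y) ^ (Fintype.card K - 1) = -y ^ (Fintype.card K - 1) := by
  have h := sum_pow_smul_sub_smul_pow (card_sub_one_pos K) x y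
  rw [← Equiv.sum_comp (Equiv.neg K)] at h
  simpa using h

end FiniteField

/-! ### Translation invariants and the transfer -/

variable {K : Type*} [Field K] {n : ℕ}

/-- Restriction of polynomials to the hyperplane `x_0 = 0`. -/
def restrictZero : MvPolynomial (Fin (n + 1)) K →ₐ[K] MvPolynomial (Fin n) K :=
  aeval (Fin.cons 0 X)

@[simp]
theorem restrictZero_X_zero : restrictZero (X 0 : MvPolynomial (Fin (n + 1)) K) = 0 := by
  simp [restrictZero]

@[simp]
theorem restrictZero_X_succ (i : Fin n) :
    restrictZero (X i.succ : MvPolynomial (Fin (n + 1)) K) = X i := by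
  simp [restrictZero]

@[simp]
theorem restrictZero_rename (f : MvPolynomial (Fin n) K) :
    restrictZero (rename Fin.succ f) = f := by
  have : restrictZero.comp (rename Fin.succ) = AlgHom.id K (MvPolynomial (Fin n) K) := by
    ext1 i; simp
  exact DFunLike.congr_fun this f

/-- The difference between f and its restriction, viewed again in n + 1 variables, is always
divisible by x_0. -/
theorem X_zero_dvd_of_restrictZero_eq_zero {f : MvPolynomial (Fin (n + 1)) K}
    (hf : restrictZero f = 0) : X 0 ∣ f := by
  have := eq_top_of_X_zero_pow_mul_rename_mem
    (((Ideal.span {(X 0 : MvPolynomial (Fin (n + 1)) K)}).restrictScalars K).comap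
      (LinearMap.id - (rename Fin.succ).toLinearMap ∘ₗ restrictZero.toLinearMap)) fun k g => by
    rw [Submodule.mem_comap, Submodule.restrictScalars_mem, Ideal.mem_span_singleton]
    rcases k with - | k
    · simp
    · simp only [LinearMap.sub_apply, LinearMap.id_apply, LinearMap.comp_apply,
        AlgHom.toLinearMap_apply, map_mul, map_pow, restrictZero_X_zero]
      rw [map_zero, zero_pow k.succ_ne_zero, zero_mul, sub_zero, pow_succ', mul_assoc]
      exact dvd_mul_right _ _
  have h : f ∈ (⊤ : Submodule K (MvPolynomial (Fin (n + 1)) K)) := trivial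
  rw [← this, Submodule.mem_comap, Submodule.restrictScalars_mem,
    Ideal.mem_span_singleton] at h
  simpa [hf] using h

theorem restrictZero_linSubst_blockMat (a : K) (u : Fin n → K) (σ : Matrix (Fin n) (Fin n) K)
    (f : MvPolynomial (Fin (n + 1)) K) :
    restrictZero (linSubst (blockMat a u σ) f) = linSubst σ (restrictZero f) := by
  have : restrictZero.comp (linSubst (blockMat a u σ)) = (linSubst σ).comp restrictZero := by
    ext1 j
    refine Fin.cases ?_ (fun j => ?_) j <;> simp
  exact DFunLike.congr_fun this f

variable [Fintype K]

/-- The substitution `x_0 ↦ x_0`, `x_i ↦ x_i ^ q - x_0 ^ (q - 1) * x_i`. -/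
def artin : MvPolynomial (Fin (n + 1)) K →ₐ[K] MvPolynomial (Fin (n + 1)) K :=
  aeval (Fin.cons (X 0) fun i =>
    X i.succ ^ Fintype.card K - X 0 ^ (Fintype.card K - 1) * X i.succ)

@[simp]
theorem artin_X_zero : artin (X 0 : MvPolynomial (Fin (n + 1)) K) = X 0 := by
  simp [artin]

@[simp]
theorem artin_X_succ (i : Fin n) : artin (X i.succ : MvPolynomial (Fin (n + 1)) K) =
    X i.succ ^ Fintype.card K - X 0 ^ (Fintype.card K - 1) * X i.succ := by
  simp [artin]

/-- Modulo x_0 the substitution is x_i ↦ x_i^q, which is injective. After the largest power of x_0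
is divided out of a nonzero kernel element, the quotient would still be divisible by x_0. -/
theorem artin_injective :
    Function.Injective (artin : MvPolynomial (Fin (n + 1)) K → MvPolynomial (Fin (n + 1)) K) := by
  rw [injective_iff_map_eq_zero]
  intro f hf
  by_contra h0
  have hX : ¬ IsUnit (X 0 : MvPolynomial (Fin (n + 1)) K) := X_prime.not_isUnit
  obtain ⟨g, hg, hdvd⟩ := (FiniteMultiplicity.of_not_isUnit hX h0).exists_eq_pow_mul_and_not_dvd
  rw [hg, map_mul, map_pow, artin_X_zero] at hf
  have hg0 : artin g = 0 := (mul_eq_zero.mp hf).resolve_left (pow_ne_zero _ (X_ne_zero 0))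
  have hcomp : restrictZero.comp artin = (expand (Fintype.card K)).comp
      (restrictZero : MvPolynomial (Fin (n + 1)) K →ₐ[K] MvPolynomial (Fin n) K) := by
    ext1 j
    refine Fin.cases ?_ (fun j => ?_) j <;> simp [(card_sub_one_pos K).ne']
  have h1 : expand (Fintype.card K) (restrictZero g) = 0 := by
    have := DFunLike.congr_fun hcomp g
    simpa [hg0] using this.symm
  exact hdvd (X_zero_dvd_of_restrictZero_eq_zero ((expand_eq_zero Fintype.card_pos).mp h1))

/-- The form x^q - x_0^{q-1} x is K-linear in x and vanishes at multiples of x_0, so the row u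
disappears; and a^{q-1} = 1. -/
theorem linSubst_blockMat_artin {a : K} (ha : a ≠ 0) (u : Fin n → K)
    (σ : Matrix (Fin n) (Fin n) K) (f : MvPolynomial (Fin (n + 1)) K) :
    linSubst (blockMat a u σ) (artin f) = artin (linSubst (blockMat a 0 σ) f) := by
  have : (linSubst (blockMat a u σ)).comp artin = artin.comp (linSubst (blockMat a 0 σ)) := by
    ext1 j
    refine Fin.cases ?_ (fun j => ?_) j
    · simp
    · have hp (x : MvPolynomial (Fin (n + 1)) K) : x ^ Fintype.card K =
        FiniteField.frobeniusAlgHom K _ x := rfl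
      simp only [AlgHom.comp_apply, artin_X_succ, map_sub, map_pow, map_mul,
        linSubst_blockMat_X_zero, linSubst_blockMat_X_succ, Pi.zero_apply, C_0, zero_mul, zero_add]
      simp only [linSubst_X, map_sum, map_mul, rename_C, rename_X, artin_X_succ]
      have hC (c : K) : artin (C c : MvPolynomial (Fin (n + 1)) K) = C c := by
        rw [← algebraMap_eq, AlgHom.commutes]
      simp only [hC, mul_pow, ← C_pow, FiniteField.pow_card_sub_one_eq_one a ha, C_1, one_mul]
      rw [hp, map_add, map_sum]
      simp only [← hp, mul_pow, ← C_pow, FiniteField.pow_card, mul_add, mul_sub,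
        Finset.sum_sub_distrib, Finset.mul_sum]
      rw [mul_left_comm, ← pow_succ, ← card_eq_card_sub_one_add_one]
      simp only [mul_left_comm (C (σ _ _))]
      ring
  exact DFunLike.congr_fun this f

/-- The sum over all translations `x_i ↦ x_i + u_i * x_0`. -/
def transfer : MvPolynomial (Fin (n + 1)) K →ₗ[K] MvPolynomial (Fin (n + 1)) K :=
  ∑ u : Fin n → K, (linSubst (blockMat 1 u 1)).toLinearMap

theorem transfer_apply (f : MvPolynomial (Fin (n + 1)) K) :
    transfer f = ∑ u : Fin n → K, linSubst (blockMat 1 u 1) f := by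
  simp [transfer]

theorem linSubst_blockMat_one_artin (u : Fin n → K) (f : MvPolynomial (Fin (n + 1)) K) :
    linSubst (blockMat 1 u 1) (artin f) = artin f := by
  rw [linSubst_blockMat_artin one_ne_zero]
  have : blockMat (1 : K) 0 1 = (1 : Matrix (Fin (n + 1)) (Fin (n + 1)) K) := by
    ext i j
    refine Fin.cases ?_ (fun i => ?_) i <;> refine Fin.cases ?_ (fun j => ?_) j <;>
      simp [blockMat, Matrix.one_apply, Fin.succ_ne_zero, (Fin.succ_ne_zero _).symm]
  rw [this, linSubst_one, AlgHom.id_apply]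

theorem transfer_mul_artin (f g : MvPolynomial (Fin (n + 1)) K) :
    transfer (f * artin g) = transfer f * artin g := by
  simp only [transfer_apply, map_mul, linSubst_blockMat_one_artin, Finset.sum_mul]

/-- Moving the block substitution past a translation changes the translation vector by an affine
bijection, since σ is invertible; the sum is only reindexed. -/
theorem transfer_linSubst_blockMat {a : K} (ha : a ≠ 0) (u : Fin n → K)
    {σ : Matrix (Fin n) (Fin n) K} (hσ : σ.det ≠ 0) (f : MvPolynomial (Fin (n + 1)) K) :
    transfer (linSubst (blockMat a u σ) f) = linSubst (blockMat a 0 σ) (transfer f) := by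
  rw [transfer_apply, transfer_apply, map_sum]
  refine Fintype.sum_bijective (fun v => a⁻¹ • (u + Matrix.vecMul v σ)) ?_ _ _ fun v =>
    linSubst_blockMat_comp ha u v σ f
  rw [← Finite.injective_iff_bijective]
  intro v w h
  have h1 := add_left_cancel (smul_right_injective _ (inv_ne_zero ha) h)
  exact Matrix.vecMul_injective_of_isUnit
    ((Matrix.isUnit_iff_isUnit_det _).mpr (isUnit_iff_ne_zero.mpr hσ)) h1

theorem transfer_prod_X_pow (a : Fin n → ℕ) :
    transfer (∏ i, X i.succ ^ a i : MvPolynomial (Fin (n + 1)) K) =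
      ∏ i, ∑ c : K, (X i.succ + c • X 0) ^ a i := by
  classical
  rw [Finset.prod_univ_sum, transfer_apply, Fintype.piFinset_univ]
  refine Finset.sum_congr rfl fun u _ => ?_
  simp [linSubst_one, smul_eq_C_mul, add_comm]

theorem transfer_prod_X_pow_eq_zero {a : Fin n → ℕ} {i : Fin n}
    (hi : a i < Fintype.card K - 1) :
    transfer (∏ i, X i.succ ^ a i : MvPolynomial (Fin (n + 1)) K) = 0 := by
  rw [transfer_prod_X_pow]
  exact Finset.prod_eq_zero (Finset.mem_univ i) (sum_add_smul_pow_of_lt hi _ _)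

/-- The product `∏ i ≥ 1, x_i ^ (q - 1)`. -/
def topMonomial (K : Type*) [Field K] [Fintype K] (n : ℕ) : MvPolynomial (Fin (n + 1)) K :=
  ∏ i : Fin n, X i.succ ^ (Fintype.card K - 1)

theorem transfer_topMonomial :
    transfer (topMonomial K n) = (-1) ^ n * X 0 ^ ((Fintype.card K - 1) * n) := by
  rw [topMonomial, transfer_prod_X_pow fun _ => Fintype.card K - 1]
  simp only [sum_add_smul_pow_card_sub_one]
  rw [Finset.prod_const, Finset.card_univ, Fintype.card_fin, neg_pow, ← pow_mul]

/-- The span of the `x^a * artin h` with all `a_i ≤ q - 1` and some `a_i < q - 1`. -/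
def lowSpan (K : Type*) [Field K] [Fintype K] (n : ℕ) : Submodule K (MvPolynomial (Fin (n + 1)) K) :=
  Submodule.span K {f | ∃ (a : Fin n → ℕ) (h : MvPolynomial (Fin (n + 1)) K),
    (∀ i, a i ≤ Fintype.card K - 1) ∧ (∃ i, a i < Fintype.card K - 1) ∧
    f = (∏ i, X i.succ ^ a i) * artin h}

/-- It suffices that the span is stable under multiplication by each variable; only raising an
exponent that is already q - 1 needs a reduction. -/
theorem span_prod_X_pow_mul_artin :
    Submodule.span K {f | ∃ (a : Fin n → ℕ) (h : MvPolynomial (Fin (n + 1)) K),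
      (∀ i, a i ≤ Fintype.card K - 1) ∧ f = (∏ i, X i.succ ^ a i) * artin h} = ⊤ := by
  rw [eq_top_iff]
  rintro f -
  induction f using MvPolynomial.induction_on with
  | C c =>
    refine Submodule.subset_span ⟨0, C c, fun i => Nat.zero_le _, ?_⟩
    rw [← algebraMap_eq, AlgHom.commutes]
    simp
  | add p q hp hq => exact Submodule.add_mem _ hp hq
  | mul_X p i hp =>
    induction hp using Submodule.span_induction with
    | zero => rw [zero_mul]; exact Submodule.zero_mem _
    | add x y _ _ hx hy => rw [add_mul]; exact Submodule.add_mem _ hx hy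
    | smul c x _ hx => rw [smul_mul_assoc]; exact Submodule.smul_mem _ _ hx
    | mem x hx =>
      obtain ⟨a, h, ha, rfl⟩ := hx
      refine Fin.cases ?_ (fun i => ?_) i
      · exact Submodule.subset_span ⟨a, h * X 0, ha, by
          rw [map_mul, artin_X_zero, mul_assoc]⟩
      · have hprod (k : ℕ) : (∏ j, X j.succ ^ Function.update a i k j :
            MvPolynomial (Fin (n + 1)) K) =
            X i.succ ^ k * ∏ j ∈ Finset.univ.erase i, X j.succ ^ a j := by
          rw [← Finset.mul_prod_erase _ _ (Finset.mem_univ i), Function.update_self]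
          congr 1
          exact Finset.prod_congr rfl fun j hj => by
            rw [Function.update_of_ne (Finset.ne_of_mem_erase hj)]
        have hup (k : ℕ) (hk : k ≤ Fintype.card K - 1) (j : Fin n) :
            Function.update a i k j ≤ Fintype.card K - 1 := by
          by_cases hj : j = i
          · subst hj; simpa using hk
          · rw [Function.update_of_ne hj]; exact ha j
        have hself : (∏ j, X j.succ ^ a j : MvPolynomial (Fin (n + 1)) K) =
            X i.succ ^ a i * ∏ j ∈ Finset.univ.erase i, X j.succ ^ a j :=
          (Finset.mul_prod_erase _ _ (Finset.mem_univ i)).symm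
        rcases (ha i).lt_or_eq with hlt | heq
        · refine Submodule.subset_span ⟨Function.update a i (a i + 1), h, hup _ hlt, ?_⟩
          rw [hprod, hself]
          ring
        -- An overflowing x_i^q is replaced by (x_i^q - x_0^{q-1} x_i) + x_0^{q-1} x_i, giving
        -- exponents 0 and 1 at i.
        · have hsum : ((∏ j, X j.succ ^ a j) * artin h * X i.succ : MvPolynomial (Fin (n + 1)) K) =
              (∏ j, X j.succ ^ Function.update a i 0 j) * artin (h * X i.succ) +
              (∏ j, X j.succ ^ Function.update a i 1 j) *
                artin (h * X 0 ^ (Fintype.card K - 1)) := by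
            rw [hprod, hprod, hself, heq, map_mul, map_mul, map_pow, artin_X_zero, artin_X_succ]
            conv_rhs => rw [card_eq_card_sub_one_add_one K]
            rw [Nat.add_sub_cancel]
            ring
          rw [hsum]
          exact Submodule.add_mem _
            (Submodule.subset_span ⟨_, _, hup 0 (Nat.zero_le _), rfl⟩)
            (Submodule.subset_span ⟨_, _, hup 1 (card_sub_one_pos K), rfl⟩)

theorem exists_sub_mem_lowSpan (f : MvPolynomial (Fin (n + 1)) K) :
    ∃ g, f - topMonomial K n * artin g ∈ lowSpan K n := by
  have hf : f ∈ (⊤ : Submodule K (MvPolynomial (Fin (n + 1)) K)) := trivial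
  rw [← span_prod_X_pow_mul_artin] at hf
  induction hf using Submodule.span_induction with
  | zero => exact ⟨0, by simp⟩
  | add x y _ _ hx hy =>
    obtain ⟨g, hg⟩ := hx
    obtain ⟨h, hh⟩ := hy
    refine ⟨g + h, ?_⟩
    rw [map_add, mul_add, add_sub_add_comm]
    exact Submodule.add_mem _ hg hh
  | smul c x _ hx =>
    obtain ⟨g, hg⟩ := hx
    refine ⟨c • g, ?_⟩
    rw [map_smul, mul_smul_comm, ← smul_sub]
    exact Submodule.smul_mem _ _ hg
  | mem x hx =>
    obtain ⟨a, h, ha, rfl⟩ := hx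
    by_cases hlow : ∃ i, a i < Fintype.card K - 1
    · refine ⟨0, ?_⟩
      rw [map_zero, mul_zero, sub_zero]
      exact Submodule.subset_span ⟨a, h, ha, hlow, rfl⟩
    · push Not at hlow
      refine ⟨h, ?_⟩
      have : a = fun _ => Fintype.card K - 1 := funext fun i => le_antisymm (ha i) (hlow i)
      simp [topMonomial, this]

theorem transfer_eq_zero_of_mem_lowSpan {f : MvPolynomial (Fin (n + 1)) K}
    (hf : f ∈ lowSpan K n) : transfer f = 0 := by
  have : lowSpan K n ≤ LinearMap.ker transfer := by
    refine Submodule.span_le.mpr ?_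
    rintro _ ⟨a, h, _, ⟨i, hi⟩, rfl⟩
    rw [SetLike.mem_coe, LinearMap.mem_ker, transfer_mul_artin, transfer_prod_X_pow_eq_zero hi,
      zero_mul]
  exact this hf

theorem transfer_topMonomial_mul_artin (g : MvPolynomial (Fin (n + 1)) K) :
    transfer (topMonomial K n * artin g) =
      X 0 ^ ((Fintype.card K - 1) * n) * artin ((-1 : K) ^ n • g) := by
  rw [transfer_mul_artin, transfer_topMonomial, map_smul, smul_eq_C_mul]
  simp only [C_pow, C_neg, C_1]
  ring

/-- With a_i < q - 1, `sum_pow_smul_sub_smul_pow` writes x_0^{q-1-a_i} x_i^{a_i} as a combination of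
translates of x_i^{q-1}, and its coefficients -c^{a_i} sum to zero. -/
theorem X_zero_pow_mul_mem_borelKer_of_mem_lowSpan {f : MvPolynomial (Fin (n + 1)) K}
    (hf : f ∈ lowSpan K n) : X 0 ^ (Fintype.card K - 1) * f ∈ borelKer K (n + 1) := by
  have : lowSpan K n ≤ (borelKer K (n + 1)).comap
      (LinearMap.mulLeft K (X 0 ^ (Fintype.card K - 1))) := by
    refine Submodule.span_le.mpr ?_
    rintro _ ⟨a, h, _, ⟨i, hi⟩, rfl⟩
    rw [SetLike.mem_coe, Submodule.mem_comap, LinearMap.mulLeft_apply]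
    -- The factor r is fixed by translations of x_i alone; x_0^{a_i} makes up the full power
    -- x_0^{q-1}.
    set r := (∏ j ∈ Finset.univ.erase i, X j.succ ^ a j) * artin h * X 0 ^ a i with hr
    set w := X i.succ ^ (Fintype.card K - 1) * r with hw
    have htrans (c : K) : linSubst (blockMat 1 (Pi.single i (-c)) 1) w =
        (X i.succ - c • X 0) ^ (Fintype.card K - 1) * r := by
      rw [hw, hr]
      simp only [map_mul, map_pow, map_prod, linSubst_blockMat_one_artin,
        linSubst_blockMat_X_zero, linSubst_blockMat_X_succ, linSubst_one, AlgHom.id_apply,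
        rename_X, C_1, one_mul, Pi.single_eq_same]
      congr 1
      · rw [smul_eq_C_mul, C_neg]; ring
      · congr 2
        refine Finset.prod_congr rfl fun j hj => ?_
        rw [Pi.single_eq_of_ne (Finset.ne_of_mem_erase hj), C_0, zero_mul, zero_add]
    -- The subtracted copies of w cost nothing, because the c^{a_i} sum to zero.
    have hsum : X 0 ^ (Fintype.card K - 1) * ((∏ i, X i.succ ^ a i) * artin h) =
        -∑ c : K, c ^ a i • (linSubst (blockMat 1 (Pi.single i (-c)) 1) w - w) := by
      simp only [htrans, smul_sub, Finset.sum_sub_distrib, ← Finset.sum_smul,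
        FiniteField.sum_pow_lt_card_sub_one K _ hi, zero_smul, sub_zero]
      simp only [← smul_mul_assoc, ← Finset.sum_mul, sum_pow_smul_sub_smul_pow hi]
      rw [hr, ← Finset.mul_prod_erase _ _ (Finset.mem_univ i),
        ← pow_sub_mul_pow (X 0 : MvPolynomial (Fin (n + 1)) K) hi.le]
      ring
    rw [hsum]
    exact Submodule.neg_mem _ (Submodule.sum_mem _ fun c _ => Submodule.smul_mem _ _
      ((IsBorel.one.blockMat one_ne_zero _).sub_mem_borelKer w))
  exact this hf

theorem exists_transfer_eq (f : MvPolynomial (Fin (n + 1)) K) :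
    ∃ g, transfer f = X 0 ^ ((Fintype.card K - 1) * n) * artin g := by
  obtain ⟨g, hg⟩ := exists_sub_mem_lowSpan f
  refine ⟨(-1 : K) ^ n • g, ?_⟩
  have := transfer_eq_zero_of_mem_lowSpan hg
  rw [map_sub, sub_eq_zero] at this
  rw [this, transfer_topMonomial_mul_artin]

theorem X_zero_pow_mul_artin_injective (k : ℕ) :
    Function.Injective fun g : MvPolynomial (Fin (n + 1)) K => X 0 ^ k * artin g :=
  fun _ _ h => artin_injective (mul_left_cancel₀ (pow_ne_zero _ (X_ne_zero 0)) h)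

/-- The transfer detects the top component, by injectivity of `artin`; if it vanishes, so does that
component, and the product with `artin g` lies in `lowSpan`. -/
theorem X_zero_pow_mul_mem_borelKer_of_transfer_eq_zero {f : MvPolynomial (Fin (n + 1)) K}
    (hf : transfer f = 0) (g : MvPolynomial (Fin (n + 1)) K) :
    X 0 ^ (Fintype.card K - 1) * (f * artin g) ∈ borelKer K (n + 1) := by
  apply X_zero_pow_mul_mem_borelKer_of_mem_lowSpan
  obtain ⟨h, hh⟩ := exists_sub_mem_lowSpan (f * artin g)
  have h1 := transfer_eq_zero_of_mem_lowSpan hh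
  rw [map_sub, transfer_mul_artin, hf, zero_mul, zero_sub, neg_eq_zero,
    transfer_topMonomial_mul_artin] at h1
  have h2 : (-1 : K) ^ n • h = 0 :=
    X_zero_pow_mul_artin_injective ((Fintype.card K - 1) * n) (by simpa using h1)
  have h3 : h = 0 := by
    simpa using (smul_eq_zero.mp h2)
  simpa [h3] using hh

/-- The transfer divided by its power of `x_0`, as a polynomial in `x_0` and the
`x_i ^ q - x_0 ^ (q - 1) * x_i`. -/
def reducedTransfer : MvPolynomial (Fin (n + 1)) K →ₗ[K] MvPolynomial (Fin (n + 1)) K where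
  toFun f := (exists_transfer_eq f).choose
  map_add' f g := X_zero_pow_mul_artin_injective ((Fintype.card K - 1) * n) <| by
    refine (exists_transfer_eq (f + g)).choose_spec.symm.trans ?_
    beta_reduce
    rw [map_add transfer, map_add artin, mul_add]
    exact congrArg₂ _ (exists_transfer_eq f).choose_spec (exists_transfer_eq g).choose_spec
  map_smul' c f := X_zero_pow_mul_artin_injective ((Fintype.card K - 1) * n) <| by
    refine (exists_transfer_eq (c • f)).choose_spec.symm.trans ?_
    beta_reduce
    rw [map_smul transfer, RingHom.id_apply, map_smul artin, mul_smul_comm]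
    exact congrArg _ (exists_transfer_eq f).choose_spec

theorem transfer_eq (f : MvPolynomial (Fin (n + 1)) K) :
    transfer f = X 0 ^ ((Fintype.card K - 1) * n) * artin (reducedTransfer f) :=
  (exists_transfer_eq f).choose_spec

theorem reducedTransfer_eq {f g : MvPolynomial (Fin (n + 1)) K}
    (h : transfer f = X 0 ^ ((Fintype.card K - 1) * n) * artin g) : reducedTransfer f = g :=
  X_zero_pow_mul_artin_injective ((Fintype.card K - 1) * n) ((transfer_eq f).symm.trans h)

theorem linSubst_blockMat_X_zero_pow {a : K} (ha : a ≠ 0) (u : Fin n → K)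
    (σ : Matrix (Fin n) (Fin n) K) (k : ℕ) :
    linSubst (blockMat a u σ) (X 0 ^ ((Fintype.card K - 1) * k)) =
      X 0 ^ ((Fintype.card K - 1) * k) := by
  rw [map_pow, linSubst_blockMat_X_zero, mul_pow, ← C_pow, pow_mul a,
    FiniteField.pow_card_sub_one_eq_one a ha, one_pow, C_1, one_mul]

theorem reducedTransfer_linSubst_blockMat {a : K} (ha : a ≠ 0) (u : Fin n → K)
    {σ : Matrix (Fin n) (Fin n) K} (hσ : σ.det ≠ 0) (f : MvPolynomial (Fin (n + 1)) K) :
    reducedTransfer (linSubst (blockMat a u σ) f) =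
      linSubst (blockMat a 0 σ) (reducedTransfer f) := by
  apply reducedTransfer_eq
  rw [transfer_linSubst_blockMat ha u hσ, transfer_eq f, map_mul,
    linSubst_blockMat_X_zero_pow ha, linSubst_blockMat_artin ha]

theorem reducedTransfer_topMonomial_mul_artin (g : MvPolynomial (Fin (n + 1)) K) :
    reducedTransfer (topMonomial K n * artin g) = (-1 : K) ^ n • g :=
  reducedTransfer_eq (transfer_topMonomial_mul_artin g)

end

/-! ### Decomposition of the cofixed space -/

section

variable {K : Type*} [Field K] {n : ℕ}

/-- The map of cofixed spaces induced by the inclusion `K[x_1, …, x_n] → K[x_0, …, x_n]`. -/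
def cofixedRename : Cofixed K n →ₗ[K] Cofixed K (n + 1) :=
  cofixedLift (Coinvariants.mk (borelRep K (n + 1)) ∘ₗ (rename Fin.succ).toLinearMap)
    fun σ hσ f => by
      simp only [LinearMap.comp_apply, AlgHom.toLinearMap_apply]
      rw [← linSubst_blockMat_rename 1 σ, mk_linSubst (hσ.blockMat one_ne_zero 0)]

theorem cofixedRename_mk (f : MvPolynomial (Fin n) K) :
    cofixedRename (Coinvariants.mk (borelRep K n) f) =
      Coinvariants.mk (borelRep K (n + 1)) (rename Fin.succ f) := rfl

/-- The map of cofixed spaces induced by setting `x_0 = 0`. -/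
def cofixedRestrict : Cofixed K (n + 1) →ₗ[K] Cofixed K n :=
  cofixedLift (Coinvariants.mk (borelRep K n) ∘ₗ restrictZero.toLinearMap)
    fun σ hσ f => by
      obtain ⟨a, u, τ, -, hτ, rfl⟩ := hσ.exists_blockMat
      simp only [LinearMap.comp_apply, AlgHom.toLinearMap_apply]
      rw [restrictZero_linSubst_blockMat, mk_linSubst hτ]

theorem cofixedRestrict_mk (f : MvPolynomial (Fin (n + 1)) K) :
    cofixedRestrict (Coinvariants.mk (borelRep K (n + 1)) f) =
      Coinvariants.mk (borelRep K n) (restrictZero f) := rfl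

theorem cofixedRestrict_cofixedRename (x : Cofixed K n) :
    cofixedRestrict (cofixedRename x) = x := by
  obtain ⟨f, rfl⟩ := Coinvariants.mk_surjective _ x
  rw [cofixedRename_mk, cofixedRestrict_mk, restrictZero_rename]

theorem cofixedRename_mem_cofixedPiece {d : ℕ} {x : Cofixed K n} (hx : x ∈ cofixedPiece K n d) :
    cofixedRename x ∈ cofixedPiece K (n + 1) d := by
  obtain ⟨f, hf, rfl⟩ := hx
  exact ⟨rename Fin.succ f, IsHomogeneous.rename_isHomogeneous hf, rfl⟩

variable [Fintype K]

/-- Some a in K has a^k ≠ 1, and the class of f is fixed by multiplication by a^k. -/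
theorem mk_eq_zero_of_not_dvd {k : ℕ} (hk : ¬ Fintype.card K - 1 ∣ k)
    {f : MvPolynomial (Fin (n + 1)) K}
    (hf : ∀ a : K, a ≠ 0 → linSubst (blockMat a 0 1) f = a ^ k • f) :
    Coinvariants.mk (borelRep K (n + 1)) f = 0 := by
  rw [← FiniteField.forall_pow_eq_one_iff K k] at hk
  push Not at hk
  obtain ⟨a, ha⟩ := hk
  have h1 := mk_linSubst (IsBorel.one.blockMat a.ne_zero (0 : Fin n → K)) f
  rw [hf a a.ne_zero, map_smul] at h1
  have h2 : ((a : K) ^ k - 1) • Coinvariants.mk (borelRep K (n + 1)) f = 0 := by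
    rw [sub_smul, one_smul, h1, sub_self]
  refine (smul_eq_zero.mp h2).resolve_left fun h => ha ?_
  ext
  simpa using sub_eq_zero.mp h

/-- Multiplication by `x_0 ^ ((q - 1) * (k + 1)) * ∏ i ≥ 1, x_i ^ (q - 1)` after the substitution
`x_i ↦ x_i ^ q - x_0 ^ (q - 1) * x_i`. -/
def thicken (k : ℕ) : MvPolynomial (Fin n) K →ₗ[K] MvPolynomial (Fin (n + 1)) K :=
  LinearMap.mulLeft K (X 0 ^ ((Fintype.card K - 1) * (k + 1)) * topMonomial K n) ∘ₗ
    (artin.comp (rename Fin.succ)).toLinearMap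

theorem thicken_apply (k : ℕ) (f : MvPolynomial (Fin n) K) :
    thicken k f = X 0 ^ ((Fintype.card K - 1) * (k + 1)) * topMonomial K n *
      artin (rename Fin.succ f) := rfl

/-- The top monomial is not Borel-invariant, but its transfer is fixed by σ, so its change under σ
has transfer zero and disappears after multiplication by x_0^{q-1}. -/
theorem mk_thicken_linSubst (k : ℕ) {σ : Matrix (Fin n) (Fin n) K} (hσ : IsBorel σ)
    (f : MvPolynomial (Fin n) K) :
    Coinvariants.mk (borelRep K (n + 1)) (thicken k (linSubst σ f)) =
      Coinvariants.mk (borelRep K (n + 1)) (thicken k f) := by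
  rw [← mk_linSubst (hσ.blockMat one_ne_zero 0) (thicken k f), eq_comm, Coinvariants.mk_eq_iff]
  have h0 : transfer (linSubst (blockMat 1 0 σ) (topMonomial K n) - topMonomial K n) = 0 := by
    rw [map_sub, transfer_linSubst_blockMat one_ne_zero 0 hσ.det_ne_zero, transfer_topMonomial,
      map_mul, linSubst_blockMat_X_zero_pow one_ne_zero, map_pow, map_neg, map_one, sub_self]
  have h1 := X_zero_pow_mul_mem_borelKer_of_transfer_eq_zero h0
    (X 0 ^ ((Fintype.card K - 1) * k) * rename Fin.succ (linSubst σ f))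
  convert h1 using 1
  rw [thicken_apply, thicken_apply, map_mul, map_mul, linSubst_blockMat_X_zero_pow one_ne_zero,
    linSubst_blockMat_artin one_ne_zero, linSubst_blockMat_rename, map_mul, map_pow, artin_X_zero]
  ring

/-- The map of cofixed spaces induced by `thicken`. -/
def cofixedThicken (k : ℕ) : Cofixed K n →ₗ[K] Cofixed K (n + 1) :=
  cofixedLift (Coinvariants.mk (borelRep K (n + 1)) ∘ₗ thicken k)
    fun _ hσ f => mk_thicken_linSubst k hσ f

theorem cofixedThicken_mk (k : ℕ) (f : MvPolynomial (Fin n) K) :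
    cofixedThicken k (Coinvariants.mk (borelRep K n) f) =
      Coinvariants.mk (borelRep K (n + 1)) (thicken k f) := rfl

/-- The map of cofixed spaces induced by the coefficient of `x_0 ^ ((q - 1) * k)` in the reduced
transfer. -/
def cofixedTransfer (k : ℕ) : Cofixed K (n + 1) →ₗ[K] Cofixed K n :=
  cofixedLift (Coinvariants.mk (borelRep K n) ∘ₗ coeffZero ((Fintype.card K - 1) * k) ∘ₗ
      reducedTransfer)
    fun σ hσ f => by
      obtain ⟨a, u, τ, ha, hτ, rfl⟩ := hσ.exists_blockMat
      simp only [LinearMap.comp_apply]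
      rw [reducedTransfer_linSubst_blockMat ha u hτ.det_ne_zero, coeffZero_linSubst_blockMat,
        pow_mul, FiniteField.pow_card_sub_one_eq_one a ha, one_pow, one_smul, mk_linSubst hτ]

/-- The index is k + 1 because `thicken l` carries x_0 to the power (q - 1)(l + 1), so the
coefficient at exponent zero never meets a thickened copy. -/
theorem cofixedTransfer_cofixedThicken (k l : ℕ) (x : Cofixed K n) :
    cofixedTransfer (k + 1) (cofixedThicken l x) = if k = l then (-1 : K) ^ n • x else 0 := by
  obtain ⟨f, rfl⟩ := Coinvariants.mk_surjective _ x
  have h : thicken l f = topMonomial K n *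
      artin (X 0 ^ ((Fintype.card K - 1) * (l + 1)) * rename Fin.succ f) := by
    rw [thicken_apply, map_mul, map_pow, artin_X_zero]; ring
  have hq : (Fintype.card K - 1) * (k + 1) = (Fintype.card K - 1) * (l + 1) ↔ k = l := by
    rw [Nat.mul_right_inj (card_sub_one_pos K).ne', Nat.succ_inj]
  rw [cofixedThicken_mk, cofixedTransfer, cofixedLift_mk, LinearMap.comp_apply,
    LinearMap.comp_apply, h, reducedTransfer_topMonomial_mul_artin, map_smul, map_smul,
    coeffZero_X_zero_pow_mul_rename]
  simp only [hq]
  split_ifs <;> simp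

theorem cofixedRestrict_cofixedThicken (k : ℕ) (x : Cofixed K n) :
    cofixedRestrict (cofixedThicken k x) = 0 := by
  obtain ⟨f, rfl⟩ := Coinvariants.mk_surjective _ x
  rw [cofixedThicken_mk, cofixedRestrict_mk, thicken_apply, map_mul restrictZero,
    map_mul restrictZero, map_pow restrictZero, restrictZero_X_zero, zero_pow (Nat.mul_ne_zero (card_sub_one_pos K).ne' k.succ_ne_zero),
    zero_mul, zero_mul, map_zero]

/-- The comparison map from copies of the cofixed space in `n` variables to the one in `n + 1`
variables. -/
def cofixedDecomposition (K : Type*) [Field K] [Fintype K] (n : ℕ) :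
    (Cofixed K n × (ℕ →₀ Cofixed K n)) →ₗ[K] Cofixed K (n + 1) :=
  cofixedRename.coprod (Finsupp.lsum K cofixedThicken)

theorem cofixedDecomposition_apply (x : Cofixed K n) (y : ℕ →₀ Cofixed K n) :
    cofixedDecomposition K n (x, y) = cofixedRename x + y.sum fun k z => cofixedThicken k z := by
  simp [cofixedDecomposition]

theorem cofixedDecomposition_injective : Function.Injective (cofixedDecomposition K n) := by
  rw [injective_iff_map_eq_zero]
  rintro ⟨x, y⟩ h
  rw [cofixedDecomposition_apply] at h
  -- Restriction comes first: it kills the thickened copies, whereas the transfers are not claimed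
  -- to kill the renamed one.
  have hx : x = 0 := by
    have := congrArg cofixedRestrict h
    simpa [cofixedRestrict_cofixedRename, Finsupp.sum, cofixedRestrict_cofixedThicken] using this
  subst hx
  rw [map_zero, zero_add] at h
  refine Prod.ext rfl (Finsupp.ext fun k => ?_)
  have := congrArg (cofixedTransfer (k + 1)) h
  simp only [Finsupp.sum, map_sum, cofixedTransfer_cofixedThicken, map_zero,
    Finset.sum_ite_eq] at this
  by_contra hk
  rw [if_pos (Finsupp.mem_support_iff.mpr hk)] at this
  exact hk (by simpa using this)

theorem mk_rename_mem_range (f : MvPolynomial (Fin n) K) :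
    Coinvariants.mk (borelRep K (n + 1)) (rename Fin.succ f) ∈
      LinearMap.range (cofixedDecomposition K n) :=
  ⟨(Coinvariants.mk _ f, 0), by simp [cofixedDecomposition_apply, cofixedRename_mk]⟩

theorem mk_thicken_mem_range (k : ℕ) (f : MvPolynomial (Fin n) K) :
    Coinvariants.mk (borelRep K (n + 1)) (thicken k f) ∈
      LinearMap.range (cofixedDecomposition K n) :=
  ⟨(0, Finsupp.single k (Coinvariants.mk _ f)), by
    simp [cofixedDecomposition_apply, cofixedThicken_mk]⟩

theorem mk_X_zero_pow_mul_topMonomial_mul_artin_mem_range (g : MvPolynomial (Fin (n + 1)) K) :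
    Coinvariants.mk (borelRep K (n + 1))
      (X 0 ^ (Fintype.card K - 1) * (topMonomial K n * artin g)) ∈
      LinearMap.range (cofixedDecomposition K n) := by
  have := eq_top_of_X_zero_pow_mul_rename_mem
    ((LinearMap.range (cofixedDecomposition K n)).comap
      (Coinvariants.mk (borelRep K (n + 1)) ∘ₗ
        LinearMap.mulLeft K (X 0 ^ (Fintype.card K - 1) * topMonomial K n) ∘ₗ
          artin.toLinearMap)) fun k f => by
    simp only [Submodule.mem_comap, LinearMap.comp_apply, LinearMap.mulLeft_apply,
      AlgHom.toLinearMap_apply, map_mul artin, map_pow artin, artin_X_zero]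
    by_cases hk : Fintype.card K - 1 ∣ k
    · obtain ⟨m, rfl⟩ := hk
      convert mk_thicken_mem_range m f using 2
      rw [thicken_apply]
      ring
    -- Under scaling of x_0 by a, the factors x_0^{q-1} and the top monomial are fixed, so the whole
    -- has weight a^k.
    · rw [mk_eq_zero_of_not_dvd hk]
      · exact Submodule.zero_mem _
      · intro a ha
        have htop : linSubst (blockMat a 0 1) (topMonomial K n) = topMonomial K n := by
          simp [topMonomial, linSubst_one]
        have hq := linSubst_blockMat_X_zero_pow ha (0 : Fin n → K) 1 1
        rw [mul_one] at hq
        rw [map_mul, map_mul, map_mul, hq, htop, linSubst_blockMat_artin ha,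
          linSubst_blockMat_rename, linSubst_one, AlgHom.id_apply, map_pow,
          linSubst_blockMat_X_zero, mul_pow, ← C_pow, smul_eq_C_mul]
        ring
  have hg : g ∈ (⊤ : Submodule K (MvPolynomial (Fin (n + 1)) K)) := trivial
  rw [← this] at hg
  simpa only [Submodule.mem_comap, LinearMap.comp_apply, LinearMap.mulLeft_apply,
      AlgHom.toLinearMap_apply, mul_assoc] using hg

theorem mk_X_zero_pow_mul_mem_range (f : MvPolynomial (Fin (n + 1)) K) :
    Coinvariants.mk (borelRep K (n + 1)) (X 0 ^ (Fintype.card K - 1) * f) ∈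
      LinearMap.range (cofixedDecomposition K n) := by
  obtain ⟨g, hg⟩ := exists_sub_mem_lowSpan f
  have h := (Coinvariants.mk_eq_zero _).mpr (X_zero_pow_mul_mem_borelKer_of_mem_lowSpan hg)
  rw [mul_sub, map_sub, sub_eq_zero] at h
  rw [h]
  exact mk_X_zero_pow_mul_topMonomial_mul_artin_mem_range g

theorem cofixedDecomposition_surjective : Function.Surjective (cofixedDecomposition K n) := by
  rw [← LinearMap.range_eq_top, eq_top_iff]
  rintro x -
  obtain ⟨f, rfl⟩ := Coinvariants.mk_surjective _ x
  have := eq_top_of_X_zero_pow_mul_rename_mem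
    ((LinearMap.range (cofixedDecomposition K n)).comap
      (Coinvariants.mk (borelRep K (n + 1)))) fun k f => by
    rw [Submodule.mem_comap]
    rcases Nat.eq_zero_or_pos k with rfl | hpos
    · rw [pow_zero, one_mul]
      exact mk_rename_mem_range f
    · by_cases hk : Fintype.card K - 1 ∣ k
      · rw [← Nat.add_sub_cancel' (Nat.le_of_dvd hpos hk), pow_add, mul_assoc]
        exact mk_X_zero_pow_mul_mem_range _
      · rw [mk_eq_zero_of_not_dvd hk]
        · exact Submodule.zero_mem _
        · intro a _
          rw [map_mul, linSubst_blockMat_rename, linSubst_one, AlgHom.id_apply, map_pow,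
            linSubst_blockMat_X_zero, mul_pow, ← C_pow, smul_eq_C_mul, mul_assoc]
  have hf : f ∈ (⊤ : Submodule K (MvPolynomial (Fin (n + 1)) K)) := trivial
  rw [← this] at hf
  exact hf

/-- The cofixed space in `n + 1` variables as a sum of copies of the one in `n` variables. -/
def cofixedEquiv (K : Type*) [Field K] [Fintype K] (n : ℕ) :
    (Cofixed K n × (ℕ →₀ Cofixed K n)) ≃ₗ[K] Cofixed K (n + 1) :=
  LinearEquiv.ofBijective (cofixedDecomposition K n)
    ⟨cofixedDecomposition_injective, cofixedDecomposition_surjective⟩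

theorem cofixedThicken_mem_cofixedPiece (k : ℕ) {d : ℕ} {x : Cofixed K n}
    (hx : x ∈ cofixedPiece K n d) :
    cofixedThicken k x ∈ cofixedPiece K (n + 1)
      ((Fintype.card K - 1) * (n + 1) + ((Fintype.card K - 1) * k + Fintype.card K * d)) := by
  obtain ⟨f, hf, rfl⟩ := hx
  refine ⟨thicken k f, ?_, rfl⟩
  have hX (i : Fin (n + 1)) (m : ℕ) : (X i ^ m : MvPolynomial (Fin (n + 1)) K).IsHomogeneous m := by
    simpa using (isHomogeneous_X K i).pow m
  have htop : (topMonomial K n).IsHomogeneous ((Fintype.card K - 1) * n) := by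
    simpa [topMonomial, mul_comm] using IsHomogeneous.prod Finset.univ
      (fun i : Fin n => (X i.succ ^ (Fintype.card K - 1) : MvPolynomial (Fin (n + 1)) K))
      (fun _ => Fintype.card K - 1) fun i _ => hX i.succ _
  have hart : (artin (rename Fin.succ f)).IsHomogeneous (Fintype.card K * d) := by
    rw [artin, aeval_rename]
    refine IsHomogeneous.aeval hf _ fun i => ?_
    simp only [Function.comp_apply, Fin.cons_succ]
    refine (hX _ _).sub ?_
    have := (hX 0 (Fintype.card K - 1)).mul (isHomogeneous_X K i.succ)
    rwa [← card_eq_card_sub_one_add_one] at this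
  have := ((hX 0 ((Fintype.card K - 1) * (k + 1))).mul htop).mul hart
  rw [SetLike.mem_coe, mem_homogeneousSubmodule, thicken_apply]
  convert this using 1
  ring

end

section

/-! ### Generating series of degree functions -/

section Counting

/-- The generating series of the cardinalities of the fibres of `deg`. -/
def degreeSeries {ι : Type*} (deg : ι → ℕ) : PowerSeries ℚ :=
  PowerSeries.mk fun d => (Nat.card {i // deg i = d} : ℚ)

variable {ι κ : Type*} {f : ι → ℕ} {g : κ → ℕ}

/-- Finiteness matters because `Nat.card` is 0 on infinite types. -/
theorem degreeSeries_sumElim (hf : ∀ d, Finite {i // f i = d}) (hg : ∀ d, Finite {i // g i = d}) :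
    degreeSeries (Sum.elim f g) = degreeSeries f + degreeSeries g := by
  ext d
  have := hf d
  have := hg d
  rw [map_add, degreeSeries, degreeSeries, degreeSeries, PowerSeries.coeff_mk, PowerSeries.coeff_mk,
    PowerSeries.coeff_mk, ← Nat.cast_add, ← Nat.card_sum]
  exact congrArg _ (Nat.card_congr Equiv.subtypeSum)

theorem degreeSeries_const_add (c : ℕ) (f : ι → ℕ) :
    degreeSeries (fun i => c + f i) = PowerSeries.X ^ c * degreeSeries f := by
  ext d
  rw [PowerSeries.coeff_X_pow_mul', degreeSeries, degreeSeries, PowerSeries.coeff_mk]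
  split_ifs with h
  · rw [PowerSeries.coeff_mk]
    refine congrArg _ (Nat.card_congr (Equiv.subtypeEquivRight fun i => ?_))
    omega
  · have : IsEmpty {i // c + f i = d} := ⟨fun i => h (by have := i.2; omega)⟩
    simp

theorem degreeSeries_const_mul {c : ℕ} (hc : c ≠ 0) (f : ι → ℕ) :
    degreeSeries (fun i => c * f i) = PowerSeries.expand c hc (degreeSeries f) := by
  ext d
  rw [PowerSeries.coeff_expand, degreeSeries, degreeSeries, PowerSeries.coeff_mk]
  split_ifs with h
  · obtain ⟨e, rfl⟩ := h
    rw [PowerSeries.coeff_mk, Nat.mul_div_cancel_left _ (Nat.pos_of_ne_zero hc)]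
    refine congrArg _ (Nat.card_congr (Equiv.subtypeEquivRight fun i => ?_))
    rw [Nat.mul_right_inj hc]
  · have : IsEmpty {i // c * f i = d} := ⟨fun i => h (i.2 ▸ dvd_mul_right _ _)⟩
    simp

theorem degreeSeries_sigma (hf : ∀ d, Finite {i // f i = d}) (hg : ∀ d, Finite {i // g i = d}) :
    degreeSeries (fun x : Σ _ : ι, κ => f x.1 + g x.2) = degreeSeries f * degreeSeries g := by
  ext d
  rw [PowerSeries.coeff_mul]
  simp only [degreeSeries, PowerSeries.coeff_mk]
  rw [← Finset.sum_coe_sort]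
  simp only [← Nat.cast_mul, ← Nat.cast_sum, ← Nat.card_prod]
  rw [← Nat.card_sigma]
  refine congrArg _ (Nat.card_congr ⟨fun x => ⟨⟨(f x.1.1, g x.1.2), by simpa using x.2⟩,
    ⟨x.1.1, rfl⟩, ⟨x.1.2, rfl⟩⟩, fun y => ⟨⟨y.2.1.1, y.2.2.1⟩, ?_⟩, ?_, ?_⟩)
  · rw [y.2.1.2, y.2.2.2]
    exact Finset.HasAntidiagonal.mem_antidiagonal.mp y.1.2
  · intro x
    rfl
  · rintro ⟨⟨⟨a, b⟩, h⟩, ⟨x, hx⟩, ⟨y, hy⟩⟩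
    change f x = a at hx
    change g y = b at hy
    subst hx hy
    rfl

theorem degreeSeries_id : degreeSeries (fun k : ℕ => k) = PowerSeries.mk 1 := by
  ext d
  simp [degreeSeries]

/-- No invertibility is required: a series with zero constant coefficient has inverse 0, and
expansion preserves the constant coefficient. -/
theorem expand_inv {c : ℕ} (hc : c ≠ 0) (φ : PowerSeries ℚ) :
    PowerSeries.expand c hc φ⁻¹ = (PowerSeries.expand c hc φ)⁻¹ := by
  by_cases h : PowerSeries.constantCoeff φ = 0
  · rw [PowerSeries.inv_eq_zero.mpr h, map_zero, eq_comm, PowerSeries.inv_eq_zero,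
      PowerSeries.constantCoeff_expand, h]
  · rw [PowerSeries.eq_inv_iff_mul_eq_one (by rwa [PowerSeries.constantCoeff_expand]), ← map_mul,
      PowerSeries.inv_mul_cancel _ h, map_one]

theorem expand_mk_one {c : ℕ} (hc : c ≠ 0) :
    PowerSeries.expand c hc (PowerSeries.mk 1 : PowerSeries ℚ) = (1 - PowerSeries.X ^ c)⁻¹ := by
  rw [PowerSeries.eq_inv_iff_mul_eq_one (by simp [hc])]
  have := congrArg (PowerSeries.expand c hc) (PowerSeries.mk_one_mul_one_sub_eq_one ℚ)
  simpa using this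

theorem degreeSeries_sumElim_sigma {c r q : ℕ} (hr : r ≠ 0) (hq : q ≠ 0)
    (hf : ∀ d, Finite {i // f i = d})
    (hg : ∀ d, Finite {x : Σ _ : ℕ, ι // c + (r * x.1 + q * f x.2) = d}) :
    degreeSeries (Sum.elim f fun x : Σ _ : ℕ, ι => c + (r * x.1 + q * f x.2)) =
      degreeSeries f + PowerSeries.X ^ c *
        ((1 - PowerSeries.X ^ r)⁻¹ * PowerSeries.expand q hq (degreeSeries f)) := by
  rw [degreeSeries_sumElim hf hg,
    degreeSeries_const_add c (fun x : Σ _ : ℕ, ι => r * x.1 + q * f x.2),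
    degreeSeries_sigma (f := fun k => r * k) (g := fun i => q * f i),
    degreeSeries_const_mul hr (fun k => k), degreeSeries_const_mul hq, degreeSeries_id,
    expand_mk_one]
  · intro d
    exact Finite.of_injective (β := Fin (d + 1)) (fun k => ⟨k.1, by
      have := Nat.le_mul_of_pos_left k.1 (Nat.pos_of_ne_zero hr)
      have := k.2
      omega⟩) fun k l h => Subtype.ext (by simpa using h)
  · intro d
    by_cases h : q ∣ d
    · obtain ⟨e, rfl⟩ := h
      have := hf e
      exact Finite.of_equiv _ (Equiv.subtypeEquivRight fun i =>
        (Nat.mul_right_inj hq (b := f i) (c := e)).symm)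
    · have : IsEmpty {i // q * f i = d} := ⟨fun i => h (i.2 ▸ dvd_mul_right _ _)⟩
      infer_instance

end Counting

/-! ### Recursion for the conjectured series -/

section ConjecturedSeries

variable {n : ℕ}

theorem sum_Iic_succ_cons (b : ℕ) (β : Fin n → ℕ) (i : Fin n) :
    ∑ j ∈ Finset.Iic i.succ, (Fin.cons b β : Fin (n + 1) → ℕ) j =
      b + ∑ j ∈ Finset.Iic i, β j := by
  have h1 : Finset.Iic i.succ = Finset.univ.filter (· ≤ i.succ) := by ext; simp
  have h2 : Finset.Iic i = Finset.univ.filter (· ≤ i) := by ext; simp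
  rw [h1, h2, Finset.sum_filter, Finset.sum_filter, Fin.sum_univ_succ]
  simp

theorem sum_Iio_succ_cons (b : ℕ) (β : Fin n → ℕ) (i : Fin n) :
    ∑ j ∈ Finset.Iio i.succ, (Fin.cons b β : Fin (n + 1) → ℕ) j =
      b + ∑ j ∈ Finset.Iio i, β j := by
  have h1 : Finset.Iio i.succ = Finset.univ.filter (· < i.succ) := by ext; simp
  have h2 : Finset.Iio i = Finset.univ.filter (· < i) := by ext; simp
  rw [h1, h2, Finset.sum_filter, Finset.sum_filter, Fin.sum_univ_succ]
  simp

theorem sum_Iic_one_succ {M : Type*} [AddCommMonoid M] (F : (Fin (n + 1) → ℕ) → M) :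
    ∑ β ∈ Finset.Iic (fun _ : Fin (n + 1) => 1), F β =
      ∑ β ∈ Finset.Iic (fun _ : Fin n => 1), F (Fin.cons 0 β) +
        ∑ β ∈ Finset.Iic (fun _ : Fin n => 1), F (Fin.cons 1 β) := by
  have h : ∑ β ∈ Finset.Iic (fun _ : Fin (n + 1) => 1), F β =
      ∑ p ∈ Finset.range 2 ×ˢ Finset.Iic (fun _ : Fin n => 1), F (Fin.cons p.1 p.2) := by
    refine Finset.sum_nbij' (fun β => (β 0, Fin.tail β)) (fun p => Fin.cons p.1 p.2) ?_ ?_ ?_ ?_ ?_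
    · intro β hβ
      rw [Finset.mem_Iic] at hβ
      rw [Finset.mem_product, Finset.mem_range, Finset.mem_Iic]
      exact ⟨Nat.lt_succ_of_le (hβ 0), fun i => hβ i.succ⟩
    · rintro ⟨b, β⟩ h
      rw [Finset.mem_product, Finset.mem_range, Finset.mem_Iic] at h
      rw [Finset.mem_Iic]
      exact Fin.cases (Nat.le_of_lt_succ h.1) h.2
    · intro β _
      exact Fin.cons_self_tail β
    · rintro ⟨b, β⟩ _
      simp
    · intro β _
      rw [Fin.cons_self_tail]
  rw [h, Finset.sum_product, Finset.sum_range_succ, Finset.sum_range_one]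

/-- For β_0 = 0 the first entry contributes 1 and the partial sums are unchanged. For β_0 = 1 each
later partial sum grows by one, so the denominator exponents are multiplied by q, and q^{1+B} - 1 =
(q - 1) + q(q^B - 1) produces the shift (q - 1)(n + 1). -/
theorem conjecturedCofixedSeries_succ {q : ℕ} (hq : q ≠ 0) :
    conjecturedCofixedSeries q (fun _ : Fin (n + 1) => 1) =
      conjecturedCofixedSeries q (fun _ : Fin n => 1) +
        PowerSeries.X ^ ((q - 1) * (n + 1)) * ((1 - PowerSeries.X ^ (q - 1))⁻¹ *
          PowerSeries.expand q hq (conjecturedCofixedSeries q (fun _ : Fin n => 1))) := by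
  have hIic : Finset.Iic (0 : Fin (n + 1)) = {0} := by ext; simp
  have hIio : Finset.Iio (0 : Fin (n + 1)) = ∅ := by ext; simp
  rw [conjecturedCofixedSeries, sum_Iic_one_succ]
  congr 1
  · refine Finset.sum_congr rfl fun β _ => ?_
    simp only [Fin.sum_univ_succ, Fin.prod_univ_succ, sum_Iic_succ_cons, sum_Iio_succ_cons, hIic,
      Finset.sum_singleton, Fin.cons_zero, Fin.cons_succ, Finset.range_zero, Finset.prod_empty,
      pow_zero, one_mul, zero_add, Nat.sub_self]
  · rw [conjecturedCofixedSeries, map_sum, Finset.mul_sum, Finset.mul_sum]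
    refine Finset.sum_congr rfl fun β _ => ?_
    simp only [Fin.sum_univ_succ, Fin.prod_univ_succ, sum_Iic_succ_cons, sum_Iio_succ_cons, hIic,
      hIio, Finset.sum_singleton, Finset.sum_empty, Fin.cons_zero, Fin.cons_succ,
      Finset.range_one, Finset.prod_singleton, one_mul, zero_add, pow_zero, pow_one, map_mul,
      map_pow, map_prod, expand_inv, map_sub, map_one, PowerSeries.expand_X, ← pow_mul]
    have hexp : q - 1 + ∑ i : Fin n, (q ^ (1 + ∑ j ∈ Finset.Iic i, β j) - 1) =
        (q - 1) * (n + 1) + q * ∑ i : Fin n, (q ^ (∑ j ∈ Finset.Iic i, β j) - 1) := by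
      have (i : Fin n) : q ^ (1 + ∑ j ∈ Finset.Iic i, β j) - 1 =
          (q - 1) + q * (q ^ (∑ j ∈ Finset.Iic i, β j) - 1) := by
        have h1 : 1 ≤ q ^ ∑ j ∈ Finset.Iic i, β j := Nat.one_le_pow _ _ (Nat.pos_of_ne_zero hq)
        have h2 := Nat.mul_le_mul_left q h1
        rw [pow_add, pow_one, Nat.mul_sub]
        omega
      simp only [this, Finset.sum_add_distrib, Finset.sum_const, Finset.card_univ,
        Fintype.card_fin, smul_eq_mul, ← Finset.mul_sum]
      ring
    rw [hexp, pow_add]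
    simp only [add_assoc, pow_add q 1, pow_one, ← Nat.mul_sub]
    ring

end ConjecturedSeries

/-! ### Homogeneous bases and the induction -/

variable {K : Type*} [Field K] {n : ℕ}

theorem finite_fibre_of_basis {ι : Type*} {deg : ι → ℕ} (b : Module.Basis ι K (Cofixed K n))
    (hb : ∀ i, b i ∈ cofixedPiece K n (deg i)) (d : ℕ) : Finite {i // deg i = d} := by
  have hli : LinearIndependent K fun i : {i // deg i = d} =>
      (⟨b i, by have := hb i.1; rwa [i.2] at this⟩ : cofixedPiece K n d) := by
    refine LinearIndependent.of_comp (cofixedPiece K n d).subtype ?_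
    exact b.linearIndependent.comp _ Subtype.val_injective
  exact hli.finite

/-- Basis vectors of other degrees lie in the other pieces, which are independent of the piece of
degree d. -/
theorem span_basis_fibre_eq {ι : Type*} {deg : ι → ℕ} (b : Module.Basis ι K (Cofixed K n))
    (hb : ∀ i, b i ∈ cofixedPiece K n (deg i)) (d : ℕ) :
    Submodule.span K (Set.range fun i : {i // deg i = d} => b i) = cofixedPiece K n d := by
  set S := Submodule.span K (Set.range fun i : {i // deg i = d} => b i)
  have hSle : S ≤ cofixedPiece K n d := Submodule.span_le.mpr (by
    rintro _ ⟨i, rfl⟩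
    have := hb i.1
    rwa [i.2] at this)
  refine le_antisymm hSle fun x hx => ?_
  have htop : x ∈ S ⊔ ⨆ (e) (_ : e ≠ d), cofixedPiece K n e := by
    have hle : Submodule.span K (Set.range b) ≤ S ⊔ ⨆ (e) (_ : e ≠ d), cofixedPiece K n e := by
      refine Submodule.span_le.mpr ?_
      rintro _ ⟨i, rfl⟩
      by_cases h : deg i = d
      · exact Submodule.mem_sup_left (Submodule.subset_span ⟨⟨i, h⟩, rfl⟩)
      · exact Submodule.mem_sup_right
          ((le_iSup₂ (f := fun e (_ : e ≠ d) => cofixedPiece K n e) (deg i) h) (hb i))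
    exact hle (by rw [b.span_eq]; trivial)
  obtain ⟨y, hy, z, hz, rfl⟩ := Submodule.mem_sup.mp htop
  have hz' : z ∈ cofixedPiece K n d := by
    simpa using Submodule.sub_mem _ hx (hSle hy)
  have hdisj := (isInternal_cofixedPiece K n).submodule_iSupIndep d
  rw [(Submodule.disjoint_def.mp hdisj) z hz' hz, add_zero]
  exact hy

theorem hilbertSeries_eq_degreeSeries {ι : Type*} {deg : ι → ℕ}
    (b : Module.Basis ι K (Cofixed K n)) (hb : ∀ i, b i ∈ cofixedPiece K n (deg i)) :
    hilbertSeries (cofixedPiece K n) = degreeSeries deg := by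
  ext d
  have := finite_fibre_of_basis b hb d
  have := Fintype.ofFinite {i // deg i = d}
  rw [hilbertSeries, degreeSeries, PowerSeries.coeff_mk, PowerSeries.coeff_mk,
    ← span_basis_fibre_eq b hb d, Nat.card_eq_fintype_card]
  exact congrArg _ (finrank_span_eq_card (b.linearIndependent.comp _ Subtype.val_injective))

theorem borelKer_zero : borelKer K 0 = ⊥ := by
  rw [eq_bot_iff]
  refine Submodule.span_le.mpr ?_
  rintro _ ⟨⟨g, f⟩, rfl⟩
  have : (g : GL (Fin 0) K) = 1 := Subsingleton.elim _ _
  have hg : g = 1 := Subtype.ext this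
  simp [hg]

variable [Fintype K]

variable (K) in
-- The induction carries a homogeneous basis, because the decomposition regrades its summands and
-- degrees are then easily followed on basis vectors.
theorem exists_homogeneous_basis (n : ℕ) :
    ∃ (ι : Type) (deg : ι → ℕ) (b : Module.Basis ι K (Cofixed K n)),
      (∀ i, b i ∈ cofixedPiece K n (deg i)) ∧
      degreeSeries deg = conjecturedCofixedSeries (Fintype.card K) (fun _ : Fin n => 1) := by
  induction n with
  | zero =>
    let e : K ≃ₗ[K] Cofixed K 0 := (isEmptyAlgEquiv K (Fin 0)).symm.toLinearEquiv.trans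
      (Submodule.quotEquivOfEqBot (borelKer K 0) borelKer_zero).symm
    refine ⟨Unit, fun _ => 0, (Module.Basis.singleton Unit K).map e, fun i => ?_, ?_⟩
    · refine ⟨1, isHomogeneous_one _ _, ?_⟩
      rw [Module.Basis.map_apply, Module.Basis.singleton_apply]
      change _ = (Coinvariants.mk (borelRep K 0)) ((isEmptyAlgEquiv K (Fin 0)).symm 1)
      rw [map_one (isEmptyAlgEquiv K (Fin 0)).symm]
    · ext d
      rw [degreeSeries, PowerSeries.coeff_mk, conjecturedCofixedSeries]
      have : Finset.Iic (fun _ : Fin 0 => 1) = {0} := by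
        ext β; simp [Subsingleton.elim β 0]
      rw [this]
      rcases Nat.eq_zero_or_pos d with rfl | hd
      · simp
      · have : IsEmpty {_i : Unit // 0 = d} := ⟨fun i => hd.ne i.2⟩
        simp [PowerSeries.coeff_one, hd.ne']
  | succ n ih =>
    obtain ⟨ι, deg, b, hb, hdeg⟩ := ih
    let c := (b.prod (Finsupp.basis fun _ : ℕ => b)).map (cofixedEquiv K n)
    let deg' : (Σ _ : ℕ, ι) → ℕ := fun x =>
      (Fintype.card K - 1) * (n + 1) + ((Fintype.card K - 1) * x.1 + Fintype.card K * deg x.2)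
    have hc (i) : c i ∈ cofixedPiece K (n + 1) (Sum.elim deg deg' i) := by
      rcases i with i | ⟨k, i⟩
      · have : c (Sum.inl i) = cofixedRename (b i) := by
          simp [c, cofixedEquiv, cofixedDecomposition, Module.Basis.prod_apply]
        rw [this]
        exact cofixedRename_mem_cofixedPiece (hb i)
      · have : c (Sum.inr ⟨k, i⟩) = cofixedThicken k (b i) := by
          simp [c, cofixedEquiv, cofixedDecomposition, Module.Basis.prod_apply]
        rw [this]
        exact cofixedThicken_mem_cofixedPiece k (hb i)
    refine ⟨_, _, c, hc, ?_⟩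
    rw [degreeSeries_sumElim_sigma (card_sub_one_pos K).ne' Fintype.card_ne_zero
      (finite_fibre_of_basis b hb), hdeg, conjecturedCofixedSeries_succ]
    -- The thickened basis vectors of degree d are part of the fibre of the whole basis `c`, which
    -- is finite because the graded piece is finite-dimensional.
    intro d
    have := finite_fibre_of_basis c hc d
    refine Finite.of_injective (fun x => (⟨Sum.inr x.1, x.2⟩ : {i // Sum.elim deg deg' i = d})) fun x y h => ?_
    exact Subtype.ext (Sum.inr_injective (Subtype.ext_iff.mp h))

end

end LRS

end

theorem mainTheorem3 {K : Type*} [Field K] [Fintype K] (n : ℕ) (hn : 1 ≤ n) :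
    LRS.hilbertSeries (LRS.cofixedPiece K n) =
      LRS.conjecturedCofixedSeries (Fintype.card K) (fun _ : Fin n => 1) := by
  obtain ⟨ι, deg, b, hb, hdeg⟩ := LRS.exists_homogeneous_basis K n
  rw [LRS.hilbertSeries_eq_degreeSeries b hb, hdeg]
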